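/- Let $M\in\{-1,0,+1\}^{m\times N}$ be a feature matrix ($m\ge 1$ examples), let $L(\lambda)=\frac1m\sum_{i=1}^m e^{-(M\lambda)_i}$ for $\lambda\in\mathbb{R}^N$ be the exponential loss, and write $\ln^+ x=\max(0,\ln x)$. AdaBoost starts from $\lambda^0=0$ and in round $t$ puts $D_t(i)\propto e^{-(M\lambda^{t-1})_i}$, chooses a column $j_t$ maximizing $|\sum_i D_t(i)M_{ij}|$ (ties broken arbitrarily), sets $r_t=\sum_i D_t(i)M_{ij_t}$ and adds $\alpha_t=\frac12\ln\frac{1+r_t}{1-r_t}$ to the $j_t$-th coordinate; if $r_t=\pm1$, then $\alpha_t=\pm\infty$, the loss becomes $0$ and AdaBoost stops (the loss stays $0$ from then on). There is an absolute constant $c>0$ such that for all $m\ge1$, $N$, all such $M$ and every $\varepsilon>0$: (1) there is $\lambda\in\mathbb{R}^N$ with $\|\lambda\|_1\le 2^{c\,m\ln m}\,\ln^+(1/\varepsilon)$ and $L(\lambda)\le\inf_{\mu\in\mathbb{R}^N}L(\mu)+\varepsilon$; (2) for every run of AdaBoost on $M$ and every integer $t\ge 2^{c\,m\ln m}\,(\ln^+(1/\varepsilon))^6\,\varepsilon^{-5}$,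 one has $L(\lambda^t)\le\inf_{\mu\in\mathbb{R}^N}L(\mu)+\varepsilon$. -/

import Mathlib

open scoped ENNReal

noncomputable section

namespace Boost

/-- The exponential loss `(1/m) ∑ᵢ exp(-(M λ)ᵢ)` of a (finite) combination `lam ∈ ℝ^N`. -/
def expLoss {m N : ℕ} (M : Matrix (Fin m) (Fin N) ℝ) (lam : Fin N → ℝ) : ℝ :=
  (1 / (m : ℝ)) * ∑ i, Real.exp (-(M.mulVec lam i))

/-- The optimal loss `inf_λ L(λ)`, the infimum being over all `λ ∈ ℝ^N`. -/
def optLoss {m N : ℕ} (M : Matrix (Fin m) (Fin N) ℝ) : ℝ :=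
  ⨅ lam : Fin N → ℝ, expLoss M lam

/-- The `ℓ₁`-norm. -/
def l1norm {N : ℕ} (lam : Fin N → ℝ) : ℝ := ∑ j, |lam j|

/-! AdaBoost. Its step `½ ln((1+r)/(1-r))` is infinite when the correlation `r` is `±1`, which
happens exactly when the chosen column of the feature matrix is constantly `+1` or constantly
`-1`; hence its combinations live in `[-∞, ∞]^N`. After such a step all margins are `+∞` and
the loss is `0`, and AdaBoost has finished. -/

/-- Margin of an extended combination on example `i`. -/
def extMargin {m N : ℕ} (M : Matrix (Fin m) (Fin N) ℝ) (lam : Fin N → EReal) (i : Fin m) :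
    EReal :=
  ∑ j, (M i j : EReal) * lam j

/-- The unnormalized weight `exp(-(M λ)ᵢ)` of example `i`. -/
def extWeight {m N : ℕ} (M : Matrix (Fin m) (Fin N) ℝ) (lam : Fin N → EReal) (i : Fin m) :
    ℝ≥0∞ :=
  EReal.exp (-(extMargin M lam i))

/-- The exponential loss of an extended combination. -/
def extLoss {m N : ℕ} (M : Matrix (Fin m) (Fin N) ℝ) (lam : Fin N → EReal) : ℝ≥0∞ :=
  (m : ℝ≥0∞)⁻¹ * ∑ i, extWeight M lam i

/-- AdaBoost's distribution on the examples: `D(i)` is proportional to `exp(-(M λ)ᵢ)`. -/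
def distr {m N : ℕ} (M : Matrix (Fin m) (Fin N) ℝ) (lam : Fin N → EReal) (i : Fin m) : ℝ :=
  (extWeight M lam i).toReal / ∑ k, (extWeight M lam k).toReal

/-- The correlation `∑ᵢ D(i) M i j` of column `j`. -/
def corr {m N : ℕ} (M : Matrix (Fin m) (Fin N) ℝ) (lam : Fin N → EReal) (j : Fin N) : ℝ :=
  ∑ i, distr M lam i * M i j

/-- AdaBoost's step size `½ ln((1+r)/(1-r))` for a correlation `r ∈ [-1, 1]`, with the values
`+∞` at `r = 1` and `-∞` at `r = -1`. -/
def stepSize (r : ℝ) : EReal :=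
  ((1 / 2 : ℝ) : EReal) * ENNReal.log (ENNReal.ofReal (1 + r) / ENNReal.ofReal (1 - r))

/-- One round of AdaBoost: a column `j` with largest absolute correlation is chosen (ties are
broken arbitrarily), and its coefficient is changed by the step size. -/
def IsRound {m N : ℕ} (M : Matrix (Fin m) (Fin N) ℝ) (lam lam' : Fin N → EReal) : Prop :=
  ∃ j : Fin N, (∀ k, |corr M lam k| ≤ |corr M lam j|) ∧
    lam' = Function.update lam j (lam j + stepSize (corr M lam j))

/-- `lam t` is the combination of AdaBoost after `t` rounds: it starts at zero, performs a round
as long as the loss is not zero, and stays where it is afterwards. -/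
structure IsAdaBoostRun {m N : ℕ} (M : Matrix (Fin m) (Fin N) ℝ) (lam : ℕ → Fin N → EReal) :
    Prop where
  init : ∀ j, lam 0 j = 0
  round : ∀ t, extLoss M (lam t) ≠ 0 → IsRound M (lam t) (lam (t + 1))
  halt : ∀ t, extLoss M (lam t) = 0 → lam (t + 1) = lam t

/-- On finite combinations the extended loss is the exponential loss. -/
theorem extLoss_coe {m N : ℕ} (hm : 0 < m) (M : Matrix (Fin m) (Fin N) ℝ) (lam : Fin N → ℝ) :
    extLoss M (fun j => (lam j : EReal)) = ENNReal.ofReal (expLoss M lam) := by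
  have h1 : ∀ i, extMargin M (fun j => (lam j : EReal)) i = ((M.mulVec lam i : ℝ) : EReal) := by
    intro i
    have key : ∀ s : Finset (Fin N), ∑ j ∈ s, (M i j : EReal) * (lam j : EReal)
        = ((∑ j ∈ s, M i j * lam j : ℝ) : EReal) := by
      intro s
      induction s using Finset.induction_on with
      | empty => simp
      | insert a s ha ih =>
        rw [Finset.sum_insert ha, Finset.sum_insert ha, ih, EReal.coe_add, EReal.coe_mul]
    exact key Finset.univ
  have h2 : ∀ i, extWeight M (fun j => (lam j : EReal)) i
      = ENNReal.ofReal (Real.exp (-(M.mulVec lam i))) := by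
    intro i
    rw [extWeight, h1, ← EReal.coe_neg, EReal.exp_coe]
  have hm' : (0 : ℝ) < m := by exact_mod_cast hm
  rw [extLoss, expLoss, ENNReal.ofReal_mul (by positivity), one_div,
    ENNReal.ofReal_inv_of_pos hm', ENNReal.ofReal_natCast,
    ENNReal.ofReal_sum_of_nonneg (fun i _ => (Real.exp_pos _).le)]
  simp only [h2]

end Boost

end

/-!
Both parts are quantitative statements about the exponential loss, and neither needs a separation
of the examples into those with vanishing and those with positive limiting loss.

*Nearly optimal combinations of small norm.* Take any `μ` whose loss exceeds the infimum by at most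
`ε / 2`, and cut its margins off at `T = log (2 m / ε)`. Its loss is at most `2`, so none of its
margins is below `-log (2 m)`, and all truncated margins lie in `[-T, T]`. The loss is monotone in
the margins, so any solution `λ` of the system `M λ ≥ b` with `b` the truncated margins is good
enough. The system is solvable, hence it has a basic solution (Carathéodory's theorem for cones,
`exists_nonneg_linearIndepOn`). Cramer's rule for the normal equations of a basic solution,
whose determinant is a nonzero integer, bounds every coefficient by `m ^ (2 m) T`
(`abs_le_of_linearIndependent_cols`, `exists_small_solution`).

*Rate of AdaBoost.* Compare with a fixed `ν` of norm at most `B`. Let `R` be the difference of the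
logarithms of the losses and `S` be `B` plus the total length of the steps made so far, an upper
bound for the distance to `ν`. Convexity gives `R ≤ ρ S` for the largest absolute correlation `ρ`
(`log_expLoss_sub_le`). A round lowers `R` by at least `-log (1 - ρ²) / 2`
(`expLoss_add_single_le`), and this is at least `ρ / 2` times the length `artanh ρ` of the step
(`mul_artanh_le`). Therefore `S R²` never grows, so that `ρ ≥ R / S ≥ (R / B)³`; the decrease
`ρ² / 2 ≥ R⁶ / (2 B⁶)` in every round yields `R⁵ t ≤ 2 B⁶` (`rate_step`, `IsAdaBoostRun.rate`).
With `ν` from the first part for `ε / 2` this is the claim, except that `log (2 / ε)` has to be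
bounded by `log (1 / ε)` as `ε` tends to `1`. There the first round alone suffices: the correlations
at the start are multiples of `1 / m`, so either `0` is optimal or the loss drops to
`√(1 - 1 / m²)` at once (`IsAdaBoostRun.extLoss_le_sqrt`).
-/

noncomputable section

namespace Boost

/-! ### Small solutions of linear inequalities -/

theorem sum_eq_sum_subtype {ι E : Type*} [Fintype ι] [AddCommMonoid E] (p : ι → Prop)
    [DecidablePred p] (f : ι → E) (hf : ∀ i, ¬p i → f i = 0) :
    ∑ i, f i = ∑ i : {i // p i}, f i := by
  rw [← Fintype.sum_subtype_add_sum_subtype p f,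
    Fintype.sum_eq_zero (fun i : {i // ¬p i} => f i) fun i => hf i i.2, add_zero]

/-- Carathéodory's theorem for cones: a nonnegative combination of finitely many vectors can be
rewritten with nonnegative coefficients so that the vectors that really occur are linearly
independent. -/
theorem exists_nonneg_linearIndepOn {ι E : Type*} [Fintype ι] [AddCommGroup E] [Module ℝ E]
    (v : ι → E) (x : ι → ℝ) (hx : ∀ i, 0 ≤ x i) :
    ∃ y : ι → ℝ, (∀ i, 0 ≤ y i) ∧ ∑ i, y i • v i = ∑ i, x i • v i ∧
      LinearIndependent ℝ (fun i : {i // y i ≠ 0} => v i) := by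
  classical
  induction hn : (Finset.univ.filter fun i => x i ≠ 0).card using Nat.strong_induction_on
    generalizing x with
  | _ n ih =>
  by_cases hli : LinearIndependent ℝ (fun i : {i // x i ≠ 0} => v i)
  · exact ⟨x, hx, rfl, hli⟩
  obtain ⟨g, hg0, i₁, hi₁⟩ := Fintype.not_linearIndependent_iff.1 hli
  obtain ⟨f, hf0, hfs, i₂, hi₂⟩ : ∃ f : ι → ℝ, ∑ i, f i • v i = 0 ∧
      (∀ i, x i = 0 → f i = 0) ∧ ∃ i, 0 < f i := by
    have hsum : ∑ i, (if h : x i ≠ 0 then g ⟨i, h⟩ else 0) • v i = 0 := by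
      rw [← hg0, sum_eq_sum_subtype (fun i => x i ≠ 0) _ fun i hi => by simp [hi]]
      exact Finset.sum_congr rfl fun i _ => by rw [dif_pos i.2]
    rcases lt_or_gt_of_ne hi₁ with h | h
    · refine ⟨fun i => -(if h : x i ≠ 0 then g ⟨i, h⟩ else 0), ?_, ?_, i₁, ?_⟩
      · simp only [neg_smul, Finset.sum_neg_distrib, hsum, neg_zero]
      · intro i hi; simp [hi]
      · simpa [i₁.2] using h
    · refine ⟨fun i => (if h : x i ≠ 0 then g ⟨i, h⟩ else 0), hsum, ?_, i₁, ?_⟩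
      · intro i hi; simp [hi]
      · simpa [i₁.2] using h
  obtain ⟨i₀, hi₀, hmin⟩ := (Finset.univ.filter fun i => 0 < f i).exists_min_image
    (fun i => x i / f i) ⟨i₂, by simpa using hi₂⟩
  have hf₀ : 0 < f i₀ := by simpa using hi₀
  -- the largest multiple of the relation `f` that can be subtracted kills the coefficient `i₀`
  set θ := x i₀ / f i₀ with hθ
  have hθ0 : 0 ≤ θ := div_nonneg (hx _) hf₀.le
  have hy : ∀ i, 0 ≤ x i - θ * f i := by
    intro i
    rcases lt_or_ge 0 (f i) with h | h
    · have := hmin i (by simpa using h)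
      rw [le_div_iff₀ h] at this
      linarith
    · have := mul_nonpos_of_nonneg_of_nonpos hθ0 h
      linarith [hx i]
  have hcard : (Finset.univ.filter fun i => x i - θ * f i ≠ 0).card < n := by
    rw [← hn]
    refine Finset.card_lt_card (Finset.ssubset_iff_of_subset ?_ |>.2 ⟨i₀, ?_, ?_⟩)
    · intro i
      simp only [Finset.mem_filter, Finset.mem_univ, true_and]
      intro h h'
      exact h (by rw [h', hfs i h']; ring)
    · simp only [Finset.mem_filter, Finset.mem_univ, true_and]
      intro h
      exact hf₀.ne' (hfs _ h)
    · simp only [Finset.mem_filter, Finset.mem_univ, true_and, not_not, hθ]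
      field_simp
      ring
  obtain ⟨y, hy0, hys, hyl⟩ := ih _ hcard (fun i => x i - θ * f i) hy rfl
  refine ⟨y, hy0, ?_, hyl⟩
  rw [hys]
  simp only [sub_smul, mul_smul, Finset.sum_sub_distrib, ← Finset.smul_sum, hf0, smul_zero, sub_zero]

/-- Cramer's rule, applied to the normal equations `Aᵀ A x = Aᵀ b`, whose determinant is a nonzero
integer. -/
theorem abs_le_of_linearIndependent_cols {m : ℕ} {κ : Type*} [Fintype κ]
    (A : Matrix (Fin m) κ ℤ) (hA : ∀ i j, |A i j| ≤ 1)
    (hli : LinearIndependent ℝ (A.map (Int.cast : ℤ → ℝ)).col) (x : κ → ℝ)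
    (hb : ∀ i, |(A.map (Int.cast : ℤ → ℝ)).mulVec x i| ≤ 1) (j : κ) :
    |x j| ≤ (m : ℝ) ^ (2 * m) := by
  classical
  set C := A.map (Int.cast : ℤ → ℝ) with hC
  have hCe : ∀ i j, |C i j| ≤ 1 := fun i j => by
    have := hA i j
    simp only [hC, Matrix.map_apply]
    exact_mod_cast this
  have hcard : Fintype.card κ ≤ m := by
    simpa using hli.fintype_card_le_finrank
  have hinj : Function.Injective C.mulVec := Matrix.mulVec_injective_iff.2 hli
  have hdet : (C.transpose * C).det ≠ 0 := by
    have := (Matrix.PosDef.conjTranspose_mul_self C hinj).det_pos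
    simpa using this.ne'
  have hint : (C.transpose * C).det = (((A.transpose * A).det : ℤ) : ℝ) := by
    have : C.transpose * C = (A.transpose * A).map (Int.cast : ℤ → ℝ) := by
      ext i j
      simp [hC, Matrix.mul_apply]
    rw [this]
    exact (Int.cast_det (R := ℝ) _).symm
  have hone : 1 ≤ |(C.transpose * C).det| := by
    rw [hint] at hdet ⊢
    have : (A.transpose * A).det ≠ 0 := by exact_mod_cast hdet
    exact_mod_cast Int.one_le_abs this
  have hsum : ∀ (i : κ) (w : Fin m → ℝ), (∀ k, |w k| ≤ 1) → |∑ k, C k i * w k| ≤ m := by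
    intro i w hw
    calc |∑ k, C k i * w k| ≤ ∑ k, |C k i * w k| := Finset.abs_sum_le_sum_abs _ _
      _ ≤ ∑ _k : Fin m, (1 : ℝ) := Finset.sum_le_sum fun k _ => by
          rw [abs_mul]; exact mul_le_one₀ (hCe _ _) (abs_nonneg _) (hw k)
      _ = m := by simp
  have hcr : (C.transpose * C).det * x j
      = ((C.transpose * C).updateCol j (C.transpose.mulVec (C.mulVec x))).det := by
    rw [← Matrix.cramer_apply, Matrix.mulVec_mulVec, Matrix.cramer_eq_adjugate_mulVec,
      Matrix.mulVec_mulVec, Matrix.adjugate_mul, Matrix.smul_mulVec, Matrix.one_mulVec]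
    simp
  have hbd : |((C.transpose * C).updateCol j (C.transpose.mulVec (C.mulVec x))).det|
      ≤ (Fintype.card κ).factorial • (m : ℝ) ^ Fintype.card κ := by
    refine Matrix.det_le (abv := AbsoluteValue.abs) (x := (m : ℝ)) fun i k => ?_
    rw [Matrix.updateCol_apply]
    split_ifs
    · exact hsum i _ hb
    · exact hsum i _ fun l => hCe l k
  have hm : 1 ≤ m := by
    have := Fintype.card_pos_iff.2 ⟨j⟩
    omega
  calc |x j| ≤ |(C.transpose * C).det| * |x j| := le_mul_of_one_le_left (abs_nonneg _) hone
    _ = |(C.transpose * C).det * x j| := (abs_mul _ _).symm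
    _ ≤ (Fintype.card κ).factorial • (m : ℝ) ^ Fintype.card κ := hcr ▸ hbd
    _ = (((Fintype.card κ).factorial * m ^ Fintype.card κ : ℕ) : ℝ) := by simp
    _ ≤ ((m ^ m * m ^ m : ℕ) : ℝ) := by
        have h1 : (Fintype.card κ).factorial ≤ m ^ m :=
          (Nat.factorial_le hcard).trans (Nat.factorial_le_pow m)
        have h2 : m ^ Fintype.card κ ≤ m ^ m := Nat.pow_le_pow_right hm hcard
        exact_mod_cast Nat.mul_le_mul h1 h2
    _ = (m : ℝ) ^ (2 * m) := by push_cast; ring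

/-- A solvable system `A x = b`, `x ≥ 0` with entries of `A` in `{-1, 0, 1}` has a basic solution,
and it is small. -/
theorem exists_small_nonneg_solution {m : ℕ} {ι : Type*} [Fintype ι]
    (A : Matrix (Fin m) ι ℝ) (hA : ∀ i j, A i j = -1 ∨ A i j = 0 ∨ A i j = 1) (T : ℝ) (hT : 0 < T)
    (x : ι → ℝ) (hx : ∀ i, 0 ≤ x i) (hb : ∀ i, |A.mulVec x i| ≤ T) :
    ∃ y : ι → ℝ, (∀ i, 0 ≤ y i) ∧ A.mulVec y = A.mulVec x ∧
      ∑ i, y i ≤ (m : ℝ) ^ (2 * m + 1) * T := by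
  classical
  obtain ⟨y, hy0, hys, hyl⟩ := exists_nonneg_linearIndepOn A.col x hx
  have hmv : A.mulVec y = A.mulVec x := by
    rw [Matrix.mulVec_eq_sum, Matrix.mulVec_eq_sum]
    simpa [Matrix.col] using hys
  refine ⟨y, hy0, hmv, ?_⟩
  have hint : ∀ i j, ∃ z : ℤ, |z| ≤ 1 ∧ (z : ℝ) = A i j := by
    intro i j
    rcases hA i j with h | h | h
    · exact ⟨-1, by simp, by simp [h]⟩
    · exact ⟨0, by simp, by simp [h]⟩
    · exact ⟨1, by simp, by simp [h]⟩
  choose Z hZ1 hZ using hint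
  let κ := {i // y i ≠ 0}
  let B : Matrix (Fin m) κ ℤ := Matrix.of fun i j => Z i j
  have hBA : ∀ i (j : κ), B.map (Int.cast : ℤ → ℝ) i j = A i j := fun i j => by simp [B, hZ]
  have hli : LinearIndependent ℝ (B.map (Int.cast : ℤ → ℝ)).col := by
    have : (B.map (Int.cast : ℤ → ℝ)).col = fun j : κ => A.col j := by
      ext j i
      exact hBA i j
    rw [this]
    exact hyl
  have hsub : ∀ g : ι → ℝ, (∀ i, y i = 0 → g i = 0) → ∑ i, g i = ∑ i : κ, g i := fun g hg =>
    sum_eq_sum_subtype _ g fun i hi => hg i (not_not.1 hi)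
  have hBm : ∀ i, (B.map (Int.cast : ℤ → ℝ)).mulVec (fun j : κ => y j / T) i
      = A.mulVec x i / T := by
    intro i
    rw [← hmv, Matrix.mulVec, Matrix.mulVec, dotProduct, dotProduct,
      hsub _ (fun j hj => by simp [hj]), Finset.sum_div]
    refine Finset.sum_congr rfl fun j _ => ?_
    rw [hBA, mul_div_assoc]
  have hent : ∀ j : κ, |y j / T| ≤ (m : ℝ) ^ (2 * m) :=
    abs_le_of_linearIndependent_cols B (fun i j => hZ1 i j) hli _ (fun i => by
      rw [hBm, abs_div, abs_of_pos hT, div_le_one hT]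
      exact hb i)
  have hcard : Fintype.card κ ≤ m := by
    simpa using hli.fintype_card_le_finrank
  calc ∑ i, y i = ∑ j : κ, y j := hsub _ fun i hi => hi
    _ ≤ ∑ _j : κ, (m : ℝ) ^ (2 * m) * T := Finset.sum_le_sum fun j _ => by
        rw [← div_le_iff₀ hT]
        exact (le_abs_self _).trans (hent j)
    _ = Fintype.card κ * ((m : ℝ) ^ (2 * m) * T) := by simp
    _ ≤ m * ((m : ℝ) ^ (2 * m) * T) := by gcongr
    _ = (m : ℝ) ^ (2 * m + 1) * T := by ring

/-- A solvable system of inequalities `M λ ≥ b` has a small solution: it is brought to the form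
`A x = b`, `x ≥ 0` by splitting `λ` into positive and negative part and adding slack variables. -/
theorem exists_small_solution {m N : ℕ} (M : Matrix (Fin m) (Fin N) ℝ)
    (hM : ∀ i j, M i j = -1 ∨ M i j = 0 ∨ M i j = 1) (b : Fin m → ℝ) (T : ℝ) (hT : 0 < T)
    (hb : ∀ i, |b i| ≤ T) (lam : Fin N → ℝ) (hlam : ∀ i, b i ≤ M.mulVec lam i) :
    ∃ lam' : Fin N → ℝ, l1norm lam' ≤ (m : ℝ) ^ (2 * m + 1) * T ∧
      ∀ i, b i ≤ M.mulVec lam' i := by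
  classical
  let A : Matrix (Fin m) (Fin N ⊕ Fin N ⊕ Fin m) ℝ :=
    Matrix.fromCols M (Matrix.fromCols (-M) (-1))
  have hAm : ∀ x, A.mulVec x = M.mulVec (fun j => x (.inl j)) -
      M.mulVec (fun j => x (.inr (.inl j))) - fun i => x (.inr (.inr i)) := by
    intro x
    simp only [A, Matrix.fromCols_mulVec, Matrix.neg_mulVec, Matrix.one_mulVec]
    ext i
    simp [Function.comp_def]
    ring
  have hA : ∀ i j, A i j = -1 ∨ A i j = 0 ∨ A i j = 1 := by
    rintro i (j | j | j)
    · exact hM i j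
    · rcases hM i j with h | h | h <;> simp [A, h]
    · rcases eq_or_ne i j with h | h <;> simp [A, h]
  let x : Fin N ⊕ Fin N ⊕ Fin m → ℝ :=
    Sum.elim (fun j => max (lam j) 0) (Sum.elim (fun j => max (-lam j) 0)
      (fun i => M.mulVec lam i - b i))
  have hx : ∀ i, 0 ≤ x i := by
    rintro (j | j | j)
    · exact le_max_right _ _
    · exact le_max_right _ _
    · exact sub_nonneg.2 (hlam j)
  have hxb : A.mulVec x = b := by
    rw [hAm, ← Matrix.mulVec_sub]
    have : (fun j => x (.inl j)) - (fun j => x (.inr (.inl j))) = lam := by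
      ext j
      simp [x]
    rw [this]
    ext i
    simp [x]
  obtain ⟨y, hy0, hyA, hys⟩ := exists_small_nonneg_solution A hA T hT x hx
    (by rw [hxb]; exact hb)
  rw [hxb, hAm, ← Matrix.mulVec_sub] at hyA
  refine ⟨(fun j => y (.inl j)) - (fun j => y (.inr (.inl j))), le_trans ?_ hys, fun i => ?_⟩
  · rw [Fintype.sum_sum_type, Fintype.sum_sum_type, ← add_assoc, ← Finset.sum_add_distrib]
    refine le_add_of_le_of_nonneg (Finset.sum_le_sum fun j _ => ?_)
      (Finset.sum_nonneg fun i _ => hy0 _)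
    simp only [Pi.sub_apply]
    rw [abs_le]
    constructor <;> linarith [hy0 (.inl j), hy0 (.inr (.inl j))]
  · have := congrFun hyA i
    simp only [Pi.sub_apply] at this
    linarith [hy0 (.inr (.inr i))]

/-! ### The exponential loss -/

theorem expLoss_pos {m N : ℕ} (hm : 0 < m) (M : Matrix (Fin m) (Fin N) ℝ) (lam : Fin N → ℝ) :
    0 < expLoss M lam := by
  have : Nonempty (Fin m) := ⟨⟨0, hm⟩⟩
  exact mul_pos (by positivity) (Finset.sum_pos (fun i _ => Real.exp_pos _) Finset.univ_nonempty)

theorem bddBelow_range_expLoss {m N : ℕ} (M : Matrix (Fin m) (Fin N) ℝ) :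
    BddBelow (Set.range (expLoss M)) := by
  refine ⟨0, ?_⟩
  rintro _ ⟨lam, rfl⟩
  exact mul_nonneg (by positivity) (Finset.sum_nonneg fun i _ => (Real.exp_pos _).le)

theorem optLoss_le {m N : ℕ} (M : Matrix (Fin m) (Fin N) ℝ) (lam : Fin N → ℝ) :
    optLoss M ≤ expLoss M lam :=
  ciInf_le (bddBelow_range_expLoss M) lam

theorem optLoss_nonneg {m N : ℕ} (hm : 0 < m) (M : Matrix (Fin m) (Fin N) ℝ) : 0 ≤ optLoss M :=
  le_ciInf fun lam => (expLoss_pos hm M lam).le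

theorem expLoss_zero {m N : ℕ} (hm : 0 < m) (M : Matrix (Fin m) (Fin N) ℝ) :
    expLoss M 0 = 1 := by
  have : (m : ℝ) ≠ 0 := by positivity
  simp [expLoss, this]

theorem l1norm_nonneg {N : ℕ} (lam : Fin N → ℝ) : 0 ≤ l1norm lam :=
  Finset.sum_nonneg fun _ _ => abs_nonneg _

theorem l1norm_smul {N : ℕ} (s : ℝ) (lam : Fin N → ℝ) : l1norm (s • lam) = |s| * l1norm lam := by
  simp [l1norm, abs_mul, Finset.mul_sum]

theorem l1norm_add_le {N : ℕ} (x y : Fin N → ℝ) : l1norm (x + y) ≤ l1norm x + l1norm y := by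
  rw [l1norm, l1norm, l1norm, ← Finset.sum_add_distrib]
  exact Finset.sum_le_sum fun j _ => abs_add_le _ _

theorem l1norm_single {N : ℕ} (j : Fin N) (a : ℝ) : l1norm (Pi.single j a) = |a| := by
  rw [l1norm, Finset.sum_eq_single j]
  · simp
  · intro k _ hk; simp [hk]
  · simp

theorem expLoss_smul_le {m N : ℕ} (hm : 0 < m) (M : Matrix (Fin m) (Fin N) ℝ) (lam : Fin N → ℝ)
    {s : ℝ} (hs0 : 0 ≤ s) (hs1 : s ≤ 1) :
    expLoss M (s • lam) ≤ (1 - s) + s * expLoss M lam := by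
  have hm' : (m : ℝ) ≠ 0 := by positivity
  have key : ∀ i, Real.exp (-(M.mulVec (s • lam) i))
      ≤ (1 - s) + s * Real.exp (-(M.mulVec lam i)) := by
    intro i
    have := convexOn_exp.2 (Set.mem_univ (0 : ℝ)) (Set.mem_univ (-(M.mulVec lam i)))
      (sub_nonneg.2 hs1) hs0 (by ring)
    simpa [Matrix.mulVec_smul] using this
  calc expLoss M (s • lam)
      ≤ 1 / (m : ℝ) * ∑ i, ((1 - s) + s * Real.exp (-(M.mulVec lam i))) := by
        unfold expLoss
        gcongr with i
        exact key i
    _ = (1 - s) + s * expLoss M lam := by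
        rw [Finset.sum_add_distrib, ← Finset.mul_sum, expLoss]
        simp only [Finset.sum_const, Finset.card_univ, Fintype.card_fin, nsmul_eq_mul]
        field_simp

/-! ### A small combination that is nearly optimal -/

/-- The margins of a nearly optimal combination are cut off at `log (2 m / ε)` and realized by a
small combination. -/
theorem exists_small_near_opt_of_le_half {m N : ℕ} (hm : 2 ≤ m) (M : Matrix (Fin m) (Fin N) ℝ)
    (hM : ∀ i j, M i j = -1 ∨ M i j = 0 ∨ M i j = 1) {ε : ℝ} (hε : 0 < ε) (hε2 : ε ≤ 1 / 2) :
    ∃ lam : Fin N → ℝ, l1norm lam ≤ (m : ℝ) ^ (5 * m) * Real.log (1 / ε) ∧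
      expLoss M lam ≤ optLoss M + ε := by
  have hm0 : 0 < m := by omega
  have hm2 : (2 : ℝ) ≤ m := by exact_mod_cast hm
  have hmpos : (0 : ℝ) < m := by linarith
  obtain ⟨mu, hmu⟩ : ∃ mu, expLoss M mu < optLoss M + ε / 2 :=
    exists_lt_of_ciInf_lt (lt_add_of_pos_right _ (half_pos hε))
  have hopt1 : optLoss M ≤ 1 := (optLoss_le M 0).trans (expLoss_zero hm0 M).le
  set T := Real.log (2 * m / ε) with hT
  have hlog : Real.log 2 ≤ Real.log (1 / ε) :=
    Real.log_le_log (by norm_num) (by rw [le_div_iff₀ hε]; linarith)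
  have hl2 : (1 : ℝ) / 2 ≤ Real.log 2 := by linarith [Real.log_two_gt_d9]
  have hTeq : T = Real.log (2 * m) + Real.log (1 / ε) := by
    rw [hT, ← Real.log_mul (by positivity) (by positivity)]
    congr 1
    ring
  have hl2m : 0 ≤ Real.log (2 * m) := Real.log_nonneg (by linarith)
  have hTpos : 0 < T := by rw [hTeq]; linarith
  have hexpT : Real.exp (-T) = ε / (2 * m) := by
    rw [Real.exp_neg, hT, Real.exp_log (by positivity), inv_div]
  -- no margin of `mu` is below `-log (2m)`, since its loss is at most `2`
  have hlow : ∀ i, -T ≤ M.mulVec mu i := by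
    intro i
    have h1 : Real.exp (-(M.mulVec mu i)) ≤ ∑ k, Real.exp (-(M.mulVec mu k)) :=
      Finset.single_le_sum (f := fun k => Real.exp (-(M.mulVec mu k)))
        (fun k _ => (Real.exp_pos _).le) (Finset.mem_univ i)
    have h2 : ∑ k, Real.exp (-(M.mulVec mu k)) = m * expLoss M mu := by
      rw [expLoss]; field_simp
    have h3 : Real.exp (-(M.mulVec mu i)) ≤ 2 * m := by nlinarith
    have h4 := (Real.le_log_iff_exp_le (by positivity)).2 h3
    linarith
  obtain ⟨lam, hl1, hlam⟩ := exists_small_solution M hM (fun i => min (M.mulVec mu i) T) T hTpos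
    (fun i => abs_le.2 ⟨le_min (hlow i) (by linarith), min_le_right _ _⟩) mu
    (fun i => min_le_left _ _)
  refine ⟨lam, hl1.trans ?_, ?_⟩
  · have h1 : T ≤ (m : ℝ) ^ 4 * Real.log (1 / ε) := by
      have h2 : Real.log (2 * m) ≤ 2 * m - 1 := Real.log_le_sub_one_of_pos (by positivity)
      have h3 : 4 * (m : ℝ) ≤ (m : ℝ) ^ 4 := by
        have : (2 : ℝ) ^ 3 ≤ (m : ℝ) ^ 3 := by gcongr
        nlinarith
      rw [hTeq]
      nlinarith
    calc (m : ℝ) ^ (2 * m + 1) * T ≤ (m : ℝ) ^ (2 * m + 1) * ((m : ℝ) ^ 4 * Real.log (1 / ε)) := by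
          gcongr
      _ = (m : ℝ) ^ (2 * m + 5) * Real.log (1 / ε) := by ring
      _ ≤ (m : ℝ) ^ (5 * m) * Real.log (1 / ε) := by
          refine mul_le_mul_of_nonneg_right ?_ (by linarith)
          exact pow_le_pow_right₀ (by linarith) (by omega)
  · have key : ∀ i, Real.exp (-(M.mulVec lam i))
        ≤ Real.exp (-(M.mulVec mu i)) + ε / (2 * m) := by
      intro i
      rw [← hexpT]
      rcases min_le_iff.1 (hlam i) with h | h
      · have := Real.exp_le_exp.2 (neg_le_neg h)
        linarith [Real.exp_pos (-T)]
      · have := Real.exp_le_exp.2 (neg_le_neg h)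
        linarith [Real.exp_pos (-(M.mulVec mu i))]
    calc expLoss M lam ≤ 1 / (m : ℝ) * ∑ i, (Real.exp (-(M.mulVec mu i)) + ε / (2 * m)) := by
          unfold expLoss
          gcongr with i
          exact key i
      _ = expLoss M mu + ε / (2 * m) := by
          rw [Finset.sum_add_distrib, expLoss]
          simp only [Finset.sum_const, Finset.card_univ, Fintype.card_fin, nsmul_eq_mul]
          field_simp
      _ ≤ expLoss M mu + ε / 2 := by gcongr; linarith
      _ ≤ optLoss M + ε := by linarith

/-- A single example is fitted along one column, without the constant factors of the general case;
these would not be covered, since `m log m = 0` for `m = 1`. -/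
theorem exists_small_near_opt_of_one {N : ℕ} (M : Matrix (Fin 1) (Fin N) ℝ)
    (hM : ∀ i j, M i j = -1 ∨ M i j = 0 ∨ M i j = 1) {ε : ℝ} (hε : 0 < ε) (hε1 : ε < 1) :
    ∃ lam : Fin N → ℝ, l1norm lam ≤ Real.log (1 / ε) ∧ expLoss M lam ≤ optLoss M + ε := by
  have hlog : 0 ≤ Real.log (1 / ε) := Real.log_nonneg (by rw [le_div_iff₀ hε]; linarith)
  by_cases h : ∃ j, M 0 j ≠ 0
  · obtain ⟨j, hj⟩ := h
    have hsq : M 0 j * M 0 j = 1 ∧ |M 0 j| = 1 := by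
      rcases hM 0 j with h | h | h
      · simp [h]
      · exact absurd h hj
      · simp [h]
    refine ⟨Pi.single j (M 0 j * Real.log (1 / ε)), ?_, ?_⟩
    · rw [l1norm_single, abs_mul, hsq.2, one_mul, abs_of_nonneg hlog]
    · have : expLoss M (Pi.single j (M 0 j * Real.log (1 / ε))) = ε := by
        have h1 : M.mulVec (Pi.single j (M 0 j * Real.log (1 / ε))) 0 = Real.log (1 / ε) := by
          rw [Matrix.mulVec_single]
          simp only [Pi.smul_apply, MulOpposite.smul_eq_mul_unop, MulOpposite.unop_op,
            Matrix.col_apply]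
          rw [← mul_assoc, hsq.1, one_mul]
        simp only [expLoss, Finset.univ_unique, Fin.default_eq_zero, Finset.sum_singleton, h1]
        rw [Real.exp_neg, Real.exp_log (by positivity)]
        simp
      rw [this]
      linarith [optLoss_nonneg one_pos M]
  · push Not at h
    have hM0 : M = 0 := by
      ext i j
      rw [Subsingleton.elim i 0]
      exact h j
    have hc : ∀ lam, expLoss M lam = 1 := fun lam => by simp [expLoss, hM0]
    refine ⟨0, by simpa [l1norm] using hlog, ?_⟩
    have : 1 ≤ optLoss M := le_ciInf fun lam => (hc lam).ge
    rw [hc]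
    linarith

theorem exists_small_near_opt {m N : ℕ} (hm : 0 < m) (M : Matrix (Fin m) (Fin N) ℝ)
    (hM : ∀ i j, M i j = -1 ∨ M i j = 0 ∨ M i j = 1) {ε : ℝ} (hε : 0 < ε) (hε1 : ε < 1) :
    ∃ lam : Fin N → ℝ, l1norm lam ≤ (m : ℝ) ^ (6 * m) * Real.log (1 / ε) ∧
      expLoss M lam ≤ optLoss M + ε := by
  obtain rfl | hm2 : m = 1 ∨ 2 ≤ m := by omega
  · simpa using exists_small_near_opt_of_one M hM hε hε1
  have hmr : (2 : ℝ) ≤ m := by exact_mod_cast hm2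
  have hlog : 0 ≤ Real.log (1 / ε) := Real.log_nonneg (by rw [le_div_iff₀ hε]; linarith)
  have hpow : (m : ℝ) ^ (5 * m) * 2 ≤ (m : ℝ) ^ (6 * m) := by
    calc (m : ℝ) ^ (5 * m) * 2 ≤ (m : ℝ) ^ (5 * m) * m := by gcongr
      _ = (m : ℝ) ^ (5 * m + 1) := by ring
      _ ≤ (m : ℝ) ^ (6 * m) := pow_le_pow_right₀ (by linarith) (by omega)
  have hp0 : 0 < (m : ℝ) ^ (5 * m) := by positivity
  rcases le_total ε (1 / 2) with h | h
  · obtain ⟨lam, h1, h2⟩ := exists_small_near_opt_of_le_half hm2 M hM hε h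
    exact ⟨lam, h1.trans (mul_le_mul_of_nonneg_right (by linarith) hlog), h2⟩
  -- for `ε` near `1` only the fraction `2 (1 - ε)` of the solution for `1/2` is taken, because the
  -- allowed norm tends to zero
  · obtain ⟨lam, h1, h2⟩ := exists_small_near_opt_of_le_half hm2 M hM (ε := 1 / 2)
      (by norm_num) le_rfl
    have hs : 1 - ε ≤ Real.log (1 / ε) := by
      rw [one_div, Real.log_inv]
      linarith [Real.log_le_sub_one_of_pos hε]
    refine ⟨(2 * (1 - ε)) • lam, ?_, ?_⟩
    · rw [l1norm_smul, abs_of_nonneg (by linarith)]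
      have hl2 : Real.log (1 / (1 / 2)) ≤ 1 := by
        norm_num
        linarith [Real.log_two_lt_d9]
      calc 2 * (1 - ε) * l1norm lam ≤ 2 * Real.log (1 / ε) * ((m : ℝ) ^ (5 * m) * 1) := by
            gcongr
            · exact l1norm_nonneg _
            · exact h1.trans (by gcongr)
        _ = (m : ℝ) ^ (5 * m) * 2 * Real.log (1 / ε) := by ring
        _ ≤ _ := by gcongr
    · have h3 := expLoss_smul_le hm M lam (s := 2 * (1 - ε)) (by linarith) (by linarith)
      nlinarith [mul_nonneg (optLoss_nonneg hm M) (show 0 ≤ 2 * ε - 1 by linarith),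
        mul_le_mul_of_nonneg_left h2 (show 0 ≤ 2 * (1 - ε) by linarith)]

/-! ### Progress in one round -/

/-- The correlation of column `j` under the distribution that a finite combination induces on the
examples. -/
def finCorr {m N : ℕ} (M : Matrix (Fin m) (Fin N) ℝ) (mu : Fin N → ℝ) (j : Fin N) : ℝ :=
  (∑ i, Real.exp (-(M.mulVec mu i)) * M i j) / ∑ i, Real.exp (-(M.mulVec mu i))

theorem sum_exp_pos {m N : ℕ} (hm : 0 < m) (M : Matrix (Fin m) (Fin N) ℝ) (mu : Fin N → ℝ) :
    0 < ∑ i, Real.exp (-(M.mulVec mu i)) := by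
  have : Nonempty (Fin m) := ⟨⟨0, hm⟩⟩
  exact Finset.sum_pos (fun i _ => Real.exp_pos _) Finset.univ_nonempty

theorem mulVec_add_single {m N : ℕ} (M : Matrix (Fin m) (Fin N) ℝ) (mu : Fin N → ℝ) (j : Fin N)
    (a : ℝ) (i : Fin m) : M.mulVec (mu + Pi.single j a) i = M.mulVec mu i + a * M i j := by
  simp [Matrix.mulVec_add]

/-- A round with correlation `r` multiplies the loss by at most `√(1 - r²)`. -/
theorem expLoss_add_single_le {m N : ℕ} (hm : 0 < m) (M : Matrix (Fin m) (Fin N) ℝ)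
    (hM : ∀ i j, M i j = -1 ∨ M i j = 0 ∨ M i j = 1) (mu : Fin N → ℝ) (j : Fin N) {r : ℝ}
    (hr : finCorr M mu j = r) (hr1 : |r| < 1) :
    expLoss M (mu + Pi.single j (1 / 2 * (Real.log (1 + r) - Real.log (1 - r))))
      ≤ √(1 - r ^ 2) * expLoss M mu := by
  obtain ⟨hr2, hr3⟩ := abs_lt.1 hr1
  have hW := sum_exp_pos hm M mu
  set W := ∑ i, Real.exp (-(M.mulVec mu i)) with hWdef
  set a := 1 / 2 * (Real.log (1 + r) - Real.log (1 - r)) with ha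
  set p := √(1 + r) with hp
  set q := √(1 - r) with hq
  have hp0 : 0 < p := Real.sqrt_pos.2 (by linarith)
  have hq0 : 0 < q := Real.sqrt_pos.2 (by linarith)
  have hp2 : p ^ 2 = 1 + r := Real.sq_sqrt (by linarith)
  have hq2 : q ^ 2 = 1 - r := Real.sq_sqrt (by linarith)
  have hea : Real.exp a = p / q := by
    have : a = Real.log (p / q) := by
      rw [Real.log_div hp0.ne' hq0.ne', hp, hq, Real.log_sqrt (by linarith),
        Real.log_sqrt (by linarith), ha]
      ring
    rw [this, Real.exp_log (by positivity)]
  have hena : Real.exp (-a) = q / p := by rw [Real.exp_neg, hea, inv_div]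
  have hpq : √(1 - r ^ 2) = p * q := by
    rw [hp, hq, ← Real.sqrt_mul (by linarith)]
    congr 1
    ring
  have hcorr : ∑ i, Real.exp (-(M.mulVec mu i)) * M i j = r * W := by
    rw [← hr, finCorr, div_mul_cancel₀ _ hW.ne']
  have key : ∀ i, Real.exp (-(a * M i j))
      ≤ (1 + M i j) / 2 * (q / p) + (1 - M i j) / 2 * (p / q) := by
    intro i
    rcases hM i j with h | h | h
    · rw [h, ← hea]; norm_num
    · rw [h, ← hea, ← hena]
      have := Real.one_le_cosh a
      rw [Real.cosh_eq] at this
      norm_num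
      linarith
    · rw [h, ← hena]; norm_num
  have hsum : ∑ i, Real.exp (-(M.mulVec (mu + Pi.single j a) i)) ≤ p * q * W := by
    calc ∑ i, Real.exp (-(M.mulVec (mu + Pi.single j a) i))
        ≤ ∑ i, Real.exp (-(M.mulVec mu i)) *
            ((1 + M i j) / 2 * (q / p) + (1 - M i j) / 2 * (p / q)) := by
          refine Finset.sum_le_sum fun i _ => ?_
          rw [mulVec_add_single, neg_add, Real.exp_add]
          exact mul_le_mul_of_nonneg_left (key i) (Real.exp_pos _).le
      _ = ∑ i, (Real.exp (-(M.mulVec mu i)) * ((q / p + p / q) / 2) +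
            Real.exp (-(M.mulVec mu i)) * M i j * ((q / p - p / q) / 2)) :=
          Finset.sum_congr rfl fun i _ => by ring
      _ = W * ((q / p + p / q) / 2) + r * W * ((q / p - p / q) / 2) := by
          rw [Finset.sum_add_distrib, ← Finset.sum_mul, ← Finset.sum_mul, hcorr]
      _ = p * q * W := by
          have h1 : W * ((q / p + p / q) / 2) + r * W * ((q / p - p / q) / 2)
              = W * ((1 + r) * (q / p) + (1 - r) * (p / q)) / 2 := by ring
          rw [h1, ← hp2, ← hq2]
          field_simp
          ring
  rw [hpq, expLoss, expLoss]
  calc 1 / (m : ℝ) * ∑ i, Real.exp (-(M.mulVec (mu + Pi.single j a) i))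
      ≤ 1 / (m : ℝ) * (p * q * W) := by gcongr
    _ = p * q * (1 / (m : ℝ) * W) := by ring

/-- If the loss of `mu` exceeds that of `nu` by much, some column has a large correlation, by
convexity of the loss. -/
theorem log_expLoss_sub_le {m N : ℕ} (hm : 0 < m) (M : Matrix (Fin m) (Fin N) ℝ)
    (mu nu : Fin N → ℝ) (ρ : ℝ) (hρ : ∀ k, |finCorr M mu k| ≤ ρ) :
    Real.log (expLoss M mu) - Real.log (expLoss M nu) ≤ ρ * l1norm (nu - mu) := by
  have hW := sum_exp_pos hm M mu
  set W := ∑ i, Real.exp (-(M.mulVec mu i)) with hWdef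
  have hW' := sum_exp_pos hm M nu
  have hm' : (0 : ℝ) < m := by positivity
  have hJ := convexOn_exp.map_sum_le (t := Finset.univ)
    (w := fun i => Real.exp (-(M.mulVec mu i)) / W) (p := fun i => -(M.mulVec (nu - mu) i))
    (fun i _ => by positivity) (by rw [← Finset.sum_div, div_self hW.ne'])
    (fun i _ => Set.mem_univ _)
  have hR : ∑ i, (Real.exp (-(M.mulVec mu i)) / W) • Real.exp (-(M.mulVec (nu - mu) i))
      = (∑ i, Real.exp (-(M.mulVec nu i))) / W := by
    rw [Finset.sum_div]
    refine Finset.sum_congr rfl fun i _ => ?_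
    rw [smul_eq_mul, div_mul_eq_mul_div, ← Real.exp_add, Matrix.mulVec_sub, Pi.sub_apply]
    ring_nf
  have hL : ∑ i, (Real.exp (-(M.mulVec mu i)) / W) • -(M.mulVec (nu - mu) i)
      = -∑ k, finCorr M mu k * (nu - mu) k := by
    simp only [smul_eq_mul, Matrix.mulVec, dotProduct, finCorr, Finset.mul_sum, Finset.sum_mul,
      Finset.sum_div, mul_neg, Finset.sum_neg_distrib]
    rw [Finset.sum_comm]
    congr 1
    refine Finset.sum_congr rfl fun k _ => Finset.sum_congr rfl fun i _ => ?_
    simp only [hWdef, Matrix.mulVec, dotProduct]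
    ring
  rw [hR, hL] at hJ
  have hle := (Real.le_log_iff_exp_le (by positivity)).2 hJ
  have hbound : ∑ k, finCorr M mu k * (nu - mu) k ≤ ρ * l1norm (nu - mu) := by
    rw [l1norm, Finset.mul_sum]
    refine Finset.sum_le_sum fun k _ => (le_abs_self _).trans ?_
    rw [abs_mul]
    gcongr
    exact hρ k
  rw [Real.log_div hW'.ne' hW.ne'] at hle
  rw [expLoss, expLoss, Real.log_mul (by positivity) hW.ne', Real.log_mul (by positivity) hW'.ne']
  linarith

/-- A step of length `artanh r` lowers the logarithm of the loss by at least `r / 2` times its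
length: the power series of both sides are compared. -/
theorem mul_artanh_le {r : ℝ} (hr : |r| < 1) :
    r * (1 / 2 * (Real.log (1 + r) - Real.log (1 - r))) ≤ -Real.log (1 - r ^ 2) := by
  have h1 := (Real.hasSum_log_sub_log_of_abs_lt_one hr).mul_left (r * (1 / 2))
  have h2 := Real.hasSum_pow_div_log_of_abs_lt_one (x := r ^ 2)
    (by rw [abs_of_nonneg (sq_nonneg r)]; exact (sq_lt_one_iff_abs_lt_one r).2 hr)
  rw [← mul_assoc]
  refine hasSum_le (fun n => ?_) h1 h2
  have h3 : r * (1 / 2) * (2 * (1 / (2 * (n : ℝ) + 1)) * r ^ (2 * n + 1))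
      = (r ^ 2) ^ (n + 1) / (2 * n + 1) := by ring
  rw [h3]
  gcongr
  linarith

theorem mul_artanh_nonneg {r : ℝ} (hr : |r| < 1) :
    0 ≤ r * (1 / 2 * (Real.log (1 + r) - Real.log (1 - r))) := by
  obtain ⟨h1, h2⟩ := abs_lt.1 hr
  rcases le_total 0 r with h | h
  · have := Real.log_le_log (by linarith) (show 1 - r ≤ 1 + r by linarith)
    exact mul_nonneg h (by linarith)
  · have := Real.log_le_log (by linarith) (show 1 + r ≤ 1 - r by linarith)
    exact mul_nonneg_of_nonpos_of_nonpos h (by linarith)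

/-- The recursion behind the rate. `R` is the excess logarithmic loss, `S` a bound on the distance
to the comparison point, `ρ` the edge and `a` the length of the step. The product `S R²` does not
grow, so `ρ ≥ R / S ≥ (R / B)³`; hence every round lowers `R` by at least `R⁶ / (2 B⁶)`. -/
theorem rate_step {R R' S B ρ a t : ℝ} (hB : 0 < B) (hS : 0 < S) (hρ0 : 0 ≤ ρ) (hρ1 : ρ < 1)
    (ha : 0 ≤ a) (ht : 0 ≤ t) (hedge : R ≤ ρ * S) (hdec : R' ≤ R + 1 / 2 * Real.log (1 - ρ ^ 2))
    (hstep : ρ * a ≤ -Real.log (1 - ρ ^ 2)) (hSR : S * R ^ 2 ≤ B ^ 3)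
    (hRt : R ^ 5 * t ≤ 2 * B ^ 6) (hR' : 0 < R') :
    (S + a) * R' ^ 2 ≤ B ^ 3 ∧ R' ^ 5 * (t + 1) ≤ 2 * B ^ 6 := by
  have hρ2 : ρ ^ 2 < 1 := by nlinarith
  have hlog : Real.log (1 - ρ ^ 2) ≤ -ρ ^ 2 := by
    linarith [Real.log_le_sub_one_of_pos (sub_pos.2 hρ2)]
  have hR : 0 < R := by nlinarith [sq_nonneg ρ]
  constructor
  · refine le_trans ?_ hSR
    -- `S` grows by the factor `1 + x`, `R` shrinks by `1 - x / 2`, and `(1 + x) (1 - x / 2) ^ 2 ≤ 1`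
    obtain ⟨x, hx⟩ : ∃ x, x = a / S := ⟨_, rfl⟩
    have hax : a = x * S := by rw [hx]; field_simp
    have hx0 : 0 ≤ x := by rw [hx]; positivity
    have h1 : R' ≤ R * (1 - x / 2) := by
      have : R * x ≤ ρ * a := by
        rw [hax]
        nlinarith
      linarith
    have hx2 : x < 2 := by
      by_contra! h
      nlinarith
    calc (S + a) * R' ^ 2 ≤ (S + a) * (R * (1 - x / 2)) ^ 2 := by gcongr
      _ = S * R ^ 2 * ((1 + x) * (1 - x / 2) ^ 2) := by rw [hax]; ring
      _ ≤ S * R ^ 2 * 1 := by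
          gcongr
          nlinarith [mul_nonneg (sq_nonneg x) (show 0 ≤ 3 - x by linarith)]
      _ = S * R ^ 2 := mul_one _
  · have hρR : R ^ 3 ≤ ρ * B ^ 3 := by
      calc R ^ 3 = R ^ 2 * R := by ring
        _ ≤ R ^ 2 * (ρ * S) := by gcongr
        _ = ρ * (S * R ^ 2) := by ring
        _ ≤ ρ * B ^ 3 := by gcongr
    have hρ6 : R ^ 6 ≤ ρ ^ 2 * B ^ 6 := by
      calc R ^ 6 = (R ^ 3) ^ 2 := by ring
        _ ≤ (ρ * B ^ 3) ^ 2 := by gcongr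
        _ = ρ ^ 2 * B ^ 6 := by ring
    obtain ⟨u, hu⟩ : ∃ u, u = R ^ 5 / (2 * B ^ 6) := ⟨_, rfl⟩
    have hu0 : 0 ≤ u := by rw [hu]; positivity
    have huR : R ^ 5 = 2 * B ^ 6 * u := by rw [hu]; field_simp
    have h1 : R' ≤ R * (1 - u) := by
      have h2 : R * u ≤ ρ ^ 2 / 2 := by
        rw [hu, mul_div_assoc', div_le_div_iff₀ (by positivity) (by norm_num)]
        nlinarith
      linarith
    have hu1 : 0 < 1 - u := by
      by_contra! h
      nlinarith
    have h5 : R' ^ 5 ≤ R ^ 5 * (1 - u) := by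
      calc R' ^ 5 ≤ (R * (1 - u)) ^ 5 := by gcongr
        _ = R ^ 5 * (1 - u) ^ 5 := by ring
        _ ≤ R ^ 5 * (1 - u) := by
            gcongr
            exact pow_le_of_le_one hu1.le (by linarith) (by norm_num)
    calc R' ^ 5 * (t + 1) ≤ R ^ 5 * (1 - u) * (t + 1) := by gcongr
      _ = (1 - u) * (R ^ 5 * t + R ^ 5) := by ring
      _ ≤ (1 - u) * (2 * B ^ 6 + 2 * B ^ 6 * u) := by rw [← huR]; gcongr
      _ = 2 * B ^ 6 * (1 - u ^ 2) := by ring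
      _ ≤ 2 * B ^ 6 * 1 := by gcongr; nlinarith [sq_nonneg u]
      _ = 2 * B ^ 6 := mul_one _

/-! ### Runs of AdaBoost in extended combinations -/

theorem extMargin_coe {m N : ℕ} (M : Matrix (Fin m) (Fin N) ℝ) (mu : Fin N → ℝ) (i : Fin m) :
    extMargin M (fun j => (mu j : EReal)) i = ((M.mulVec mu i : ℝ) : EReal) := by
  simp only [extMargin, ← EReal.coe_mul, Matrix.mulVec, dotProduct]
  exact (map_sum (⟨⟨Real.toEReal, EReal.coe_zero⟩, EReal.coe_add⟩ : ℝ →+ EReal) _ _).symm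

theorem extWeight_coe {m N : ℕ} (M : Matrix (Fin m) (Fin N) ℝ) (mu : Fin N → ℝ) (i : Fin m) :
    extWeight M (fun j => (mu j : EReal)) i = ENNReal.ofReal (Real.exp (-(M.mulVec mu i))) := by
  rw [extWeight, extMargin_coe, ← EReal.coe_neg, EReal.exp_coe]

theorem corr_coe {m N : ℕ} (M : Matrix (Fin m) (Fin N) ℝ) (mu : Fin N → ℝ) (j : Fin N) :
    corr M (fun j => (mu j : EReal)) j = finCorr M mu j := by
  simp only [corr, distr, extWeight_coe, ENNReal.toReal_ofReal (Real.exp_pos _).le, finCorr,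
    Finset.sum_div]
  exact Finset.sum_congr rfl fun i _ => by ring

theorem stepSize_of_abs_lt_one {r : ℝ} (hr : |r| < 1) :
    stepSize r = ((1 / 2 * (Real.log (1 + r) - Real.log (1 - r)) : ℝ) : EReal) := by
  obtain ⟨h1, h2⟩ := abs_lt.1 hr
  have h3 : 0 < 1 + r := by linarith
  have h4 : 0 < 1 - r := by linarith
  rw [stepSize, ← ENNReal.ofReal_div_of_pos h4, ENNReal.log_ofReal_of_pos (by positivity),
    Real.log_div h3.ne' h4.ne', EReal.coe_mul]

theorem stepSize_one : stepSize 1 = ⊤ := by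
  rw [stepSize, sub_self, ENNReal.ofReal_zero, ENNReal.div_zero (by norm_num), ENNReal.log_top]
  exact EReal.coe_mul_top_of_pos (by norm_num)

theorem stepSize_neg_one : stepSize (-1) = ⊥ := by
  rw [stepSize, add_neg_cancel, ENNReal.ofReal_zero, ENNReal.zero_div, ENNReal.log_zero]
  exact EReal.coe_mul_bot_of_pos (by norm_num)

theorem abs_finCorr_le_one {m N : ℕ} (hm : 0 < m) (M : Matrix (Fin m) (Fin N) ℝ)
    (hM : ∀ i j, M i j = -1 ∨ M i j = 0 ∨ M i j = 1) (mu : Fin N → ℝ) (j : Fin N) :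
    |finCorr M mu j| ≤ 1 := by
  have hW := sum_exp_pos hm M mu
  rw [finCorr, abs_div, abs_of_pos hW, div_le_one hW]
  refine (Finset.abs_sum_le_sum_abs _ _).trans (Finset.sum_le_sum fun i _ => ?_)
  rw [abs_mul, abs_of_pos (Real.exp_pos _)]
  refine mul_le_of_le_one_right (Real.exp_pos _).le ?_
  rcases hM i j with h | h | h <;> simp [h]

/-- The correlation is a weighted average of the entries with positive weights, so it attains an
extreme value `±1` only for a constant column. -/
theorem eq_of_finCorr_eq {m N : ℕ} (hm : 0 < m) (M : Matrix (Fin m) (Fin N) ℝ)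
    (hM : ∀ i j, M i j = -1 ∨ M i j = 0 ∨ M i j = 1) (mu : Fin N → ℝ) (j : Fin N) {s : ℝ}
    (hs : s * s = 1) (h : finCorr M mu j = s) (i : Fin m) : M i j = s := by
  have hW := sum_exp_pos hm M mu
  rw [finCorr, div_eq_iff hW.ne'] at h
  have hs2 : s = 1 ∨ s = -1 := mul_self_eq_one_iff.1 hs
  have hzero : ∑ i, Real.exp (-(M.mulVec mu i)) * (1 - s * M i j) = 0 := by
    calc ∑ i, Real.exp (-(M.mulVec mu i)) * (1 - s * M i j)
        = ∑ i, Real.exp (-(M.mulVec mu i)) - s * ∑ i, Real.exp (-(M.mulVec mu i)) * M i j := by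
          rw [Finset.mul_sum, ← Finset.sum_sub_distrib]
          exact Finset.sum_congr rfl fun i _ => by ring
      _ = 0 := by rw [h, ← mul_assoc, hs]; ring
  have hnn : ∀ i ∈ Finset.univ, 0 ≤ Real.exp (-(M.mulVec mu i)) * (1 - s * M i j) := fun i _ => by
    refine mul_nonneg (Real.exp_pos _).le ?_
    rcases hs2 with rfl | rfl <;> rcases hM i j with h | h | h <;> norm_num [h]
  have := (Finset.sum_eq_zero_iff_of_nonneg hnn).1 hzero i (Finset.mem_univ i)
  have h1 : 1 - s * M i j = 0 := by
    rcases mul_eq_zero.1 this with h | h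
    · exact absurd h (Real.exp_pos _).ne'
    · exact h
  linear_combination (-s) * h1 - M i j * hs

/-- An infinite step along a column of ones or of minus ones, in its own direction, sends all
margins to `+∞`. -/
theorem extLoss_update_eq_zero {m N : ℕ} (M : Matrix (Fin m) (Fin N) ℝ) (mu : Fin N → ℝ)
    (j : Fin N) (a : EReal) (ha : ∀ i, (M i j : EReal) * a = ⊤) :
    extLoss M (Function.update (fun k => (mu k : EReal)) j a) = 0 := by
  have hmar : ∀ i, extMargin M (Function.update (fun k => (mu k : EReal)) j a) i = ⊤ := by
    intro i
    rw [extMargin, ← Finset.add_sum_erase _ _ (Finset.mem_univ j), Function.update_self, ha]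
    have : ∑ k ∈ Finset.univ.erase j,
        (M i k : EReal) * Function.update (fun k => (mu k : EReal)) j a k
        = ((∑ k ∈ Finset.univ.erase j, M i k * mu k : ℝ) : EReal) := by
      rw [show ((∑ k ∈ Finset.univ.erase j, M i k * mu k : ℝ) : EReal)
        = ∑ k ∈ Finset.univ.erase j, ((M i k * mu k : ℝ) : EReal) from
        map_sum (⟨⟨Real.toEReal, EReal.coe_zero⟩, EReal.coe_add⟩ : ℝ →+ EReal) _ _]
      refine Finset.sum_congr rfl fun k hk => ?_
      rw [Function.update_of_ne (Finset.ne_of_mem_erase hk), EReal.coe_mul]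
    rw [this, EReal.top_add_coe]
  simp [extLoss, extWeight, hmar]

/-- A round that starts from a finite combination either makes a finite step or ends with loss
zero. -/
theorem IsRound.of_coe {m N : ℕ} (hm : 0 < m) {M : Matrix (Fin m) (Fin N) ℝ}
    (hM : ∀ i j, M i j = -1 ∨ M i j = 0 ∨ M i j = 1) {mu : Fin N → ℝ} {lam' : Fin N → EReal}
    (h : IsRound M (fun k => (mu k : EReal)) lam') :
    extLoss M lam' = 0 ∨ ∃ j, (∀ k, |finCorr M mu k| ≤ |finCorr M mu j|) ∧ |finCorr M mu j| < 1 ∧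
      lam' = fun k => (((mu + Pi.single j (1 / 2 * (Real.log (1 + finCorr M mu j)
        - Real.log (1 - finCorr M mu j))) : Fin N → ℝ) k : ℝ) : EReal) := by
  obtain ⟨j, hj, rfl⟩ := h
  simp only [corr_coe] at hj ⊢
  rcases (abs_finCorr_le_one hm M hM mu j).lt_or_eq with h1 | h1
  · refine Or.inr ⟨j, hj, h1, ?_⟩
    rw [stepSize_of_abs_lt_one h1]
    ext k
    rcases eq_or_ne k j with rfl | hk
    · simp
    · simp [hk]
  · left
    rcases eq_or_eq_neg_of_abs_eq h1 with h2 | h2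
    · rw [h2, stepSize_one, EReal.coe_add_top]
      refine extLoss_update_eq_zero M mu j _ fun i => ?_
      rw [eq_of_finCorr_eq hm M hM mu j (by norm_num) h2 i]
      simp
    · rw [h2, stepSize_neg_one, EReal.add_bot]
      refine extLoss_update_eq_zero M mu j _ fun i => ?_
      rw [eq_of_finCorr_eq hm M hM mu j (by norm_num) h2 i]
      simp

/-- A run of AdaBoost stays finite until its loss is zero, so that a property of its combinations
can be proved by induction over finite rounds. -/
theorem IsAdaBoostRun.induction {m N : ℕ} (hm : 0 < m) {M : Matrix (Fin m) (Fin N) ℝ}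
    (hM : ∀ i j, M i j = -1 ∨ M i j = 0 ∨ M i j = 1) {lam : ℕ → Fin N → EReal}
    (hrun : IsAdaBoostRun M lam) (P : ℕ → (Fin N → ℝ) → Prop) (h0 : P 0 0)
    (hstep : ∀ t mu j, P t mu → (∀ k, |finCorr M mu k| ≤ |finCorr M mu j|) →
      |finCorr M mu j| < 1 → P (t + 1) (mu + Pi.single j (1 / 2 *
        (Real.log (1 + finCorr M mu j) - Real.log (1 - finCorr M mu j))))) (t : ℕ) :
    extLoss M (lam t) = 0 ∨ ∃ mu, lam t = (fun k => ((mu k : ℝ) : EReal)) ∧ P t mu := by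
  induction t with
  | zero => exact Or.inr ⟨0, by ext k; simp [hrun.init], h0⟩
  | succ t ih =>
    by_cases hz : extLoss M (lam t) = 0
    · left; rw [hrun.halt t hz, hz]
    · obtain ⟨mu, hmu, hP⟩ := ih.resolve_left hz
      have hr := hrun.round t hz
      rw [hmu] at hr
      rcases hr.of_coe hm hM with h | ⟨j, hj, hj1, h⟩
      · exact Or.inl h
      · exact Or.inr ⟨_, h, hstep t mu j hP hj hj1⟩

/-! ### The rate of convergence -/

theorem sqrt_one_sub_sq_le_one (r : ℝ) : √(1 - r ^ 2) ≤ 1 :=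
  Real.sqrt_le_one.2 (by nlinarith [sq_nonneg r])

theorem expLoss_add_single_le_self {m N : ℕ} (hm : 0 < m) (M : Matrix (Fin m) (Fin N) ℝ)
    (hM : ∀ i j, M i j = -1 ∨ M i j = 0 ∨ M i j = 1) (mu : Fin N → ℝ) (j : Fin N)
    (hr1 : |finCorr M mu j| < 1) :
    expLoss M (mu + Pi.single j (1 / 2 * (Real.log (1 + finCorr M mu j)
      - Real.log (1 - finCorr M mu j)))) ≤ expLoss M mu :=
  (expLoss_add_single_le hm M hM mu j rfl hr1).trans
    (mul_le_of_le_one_left (expLoss_pos hm M mu).le (sqrt_one_sub_sq_le_one _))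

/-- At the combination `0` all correlations are multiples of `1 / m`. Hence either `0` is optimal
or the first round makes noticeable progress. -/
theorem one_le_optLoss_or_first_round {m N : ℕ} (hm : 0 < m) {M : Matrix (Fin m) (Fin N) ℝ}
    (hM : ∀ i j, M i j = -1 ∨ M i j = 0 ∨ M i j = 1) :
    1 ≤ optLoss M ∨ ∀ j, (∀ k, |finCorr M 0 k| ≤ |finCorr M 0 j|) →
      1 / (m : ℝ) ≤ |finCorr M 0 j| := by
  have hm' : (0 : ℝ) < m := by positivity
  have hint : ∀ j, ∃ z : ℤ, finCorr M 0 j = z / m := by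
    intro j
    have : ∀ i, ∃ z : ℤ, M i j = z := by
      intro i
      rcases hM i j with h | h | h
      · exact ⟨-1, by simp [h]⟩
      · exact ⟨0, by simp [h]⟩
      · exact ⟨1, by simp [h]⟩
    choose z hz using this
    exact ⟨∑ i, z i, by simp [finCorr, hz]⟩
  by_cases hall : ∀ k, finCorr M 0 k = 0
  · left
    refine le_ciInf fun nu => ?_
    have h1 := log_expLoss_sub_le hm M 0 nu 0 (fun k => by simp [hall k])
    rw [expLoss_zero hm, Real.log_one, zero_mul, zero_sub, neg_nonpos] at h1
    exact (Real.log_nonneg_iff (expLoss_pos hm M nu)).1 h1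
  · right
    push Not at hall
    obtain ⟨k, hk⟩ := hall
    intro j hj
    refine le_trans ?_ (hj k)
    obtain ⟨z, hz⟩ := hint k
    have hz0 : z ≠ 0 := by
      rintro rfl
      exact hk (by simp [hz])
    rw [hz, abs_div, abs_of_pos hm']
    gcongr
    exact_mod_cast Int.one_le_abs hz0

theorem IsAdaBoostRun.extLoss_le_one {m N : ℕ} (hm : 0 < m) {M : Matrix (Fin m) (Fin N) ℝ}
    (hM : ∀ i j, M i j = -1 ∨ M i j = 0 ∨ M i j = 1) {lam : ℕ → Fin N → EReal}
    (hrun : IsAdaBoostRun M lam) (t : ℕ) : extLoss M (lam t) ≤ 1 := by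
  rcases hrun.induction hm hM (fun _ mu => expLoss M mu ≤ 1) (expLoss_zero hm M).le
    (fun t mu j h _ hj1 => (expLoss_add_single_le_self hm M hM mu j hj1).trans h) t
    with h | ⟨mu, hmu, h⟩
  · rw [h]; exact zero_le_one
  · rw [hmu, extLoss_coe hm]
    exact ENNReal.ofReal_le_one.2 h

/-- If `0` is not optimal, the first round brings the loss down to `√(1 - 1 / m²)`, and it stays
below. For `m = 1` the bound is `0`. -/
theorem IsAdaBoostRun.extLoss_le_sqrt {m N : ℕ} (hm : 0 < m) {M : Matrix (Fin m) (Fin N) ℝ}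
    (hM : ∀ i j, M i j = -1 ∨ M i j = 0 ∨ M i j = 1) {lam : ℕ → Fin N → EReal}
    (hrun : IsAdaBoostRun M lam) (hopt : optLoss M < 1) {t : ℕ} (ht : 0 < t) :
    extLoss M (lam t) ≤ ENNReal.ofReal √(1 - (1 / (m : ℝ)) ^ 2) := by
  have hfirst := (one_le_optLoss_or_first_round hm hM).resolve_left hopt.not_ge
  refine Or.elim (hrun.induction hm hM
    (fun t mu => (t = 0 → mu = 0) ∧ (0 < t → expLoss M mu ≤ √(1 - (1 / (m : ℝ)) ^ 2)))
    (by simp) ?_ t) (fun h => ?_) fun ⟨mu, hmu, h⟩ => ?_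
  · rintro t mu j ⟨h1, h2⟩ hj hj1
    refine ⟨fun h => absurd h (Nat.succ_ne_zero t), fun _ => ?_⟩
    rcases Nat.eq_zero_or_pos t with rfl | ht
    -- only the very first combination is known to be `0`; later rounds just keep the bound
    · obtain rfl := h1 rfl
      refine (expLoss_add_single_le hm M hM 0 j rfl hj1).trans ?_
      rw [expLoss_zero hm, mul_one]
      refine Real.sqrt_le_sqrt ?_
      rw [← sq_abs (finCorr M 0 j)]
      have := hfirst j hj
      gcongr
    · exact (expLoss_add_single_le_self hm M hM mu j hj1).trans (h2 ht)
  · rw [h]; exact zero_le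
  · rw [hmu, extLoss_coe hm]
    exact ENNReal.ofReal_le_ofReal (h.2 ht)

/-- AdaBoost compared with a combination `nu` of norm at most `B`: after `t` rounds the excess `R`
of its logarithmic loss satisfies `R⁵ t ≤ 2 B⁶`. -/
theorem IsAdaBoostRun.rate {m N : ℕ} (hm : 0 < m) {M : Matrix (Fin m) (Fin N) ℝ}
    (hM : ∀ i j, M i j = -1 ∨ M i j = 0 ∨ M i j = 1) {lam : ℕ → Fin N → EReal}
    (hrun : IsAdaBoostRun M lam) (nu : Fin N → ℝ) {B : ℝ} (hB : 0 < B) (hnu : l1norm nu ≤ B)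
    (t : ℕ) :
    extLoss M (lam t) = 0 ∨ ∃ mu, lam t = (fun k => ((mu k : ℝ) : EReal)) ∧ expLoss M mu ≤ 1 ∧
      (0 < Real.log (expLoss M mu) - Real.log (expLoss M nu) →
        (Real.log (expLoss M mu) - Real.log (expLoss M nu)) ^ 5 * t ≤ 2 * B ^ 6) := by
  refine (hrun.induction hm hM (fun t mu => expLoss M mu ≤ 1 ∧
    (0 < Real.log (expLoss M mu) - Real.log (expLoss M nu) → ∃ S, 0 < S ∧ l1norm (nu - mu) ≤ S ∧
      S * (Real.log (expLoss M mu) - Real.log (expLoss M nu)) ^ 2 ≤ B ^ 3 ∧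
      (Real.log (expLoss M mu) - Real.log (expLoss M nu)) ^ 5 * t ≤ 2 * B ^ 6)) ?_ ?_ t).imp_right
    fun ⟨mu, hmu, h1, h2⟩ => ⟨mu, hmu, h1, fun hpos => (h2 hpos).choose_spec.2.2.2⟩
  · refine ⟨(expLoss_zero hm M).le, fun hpos => ⟨B, hB, by simpa using hnu, ?_, ?_⟩⟩
    · have h1 := log_expLoss_sub_le hm M 0 nu 1 (fun k => abs_finCorr_le_one hm M hM 0 k)
      rw [one_mul, sub_zero] at h1
      calc B * (Real.log (expLoss M 0) - Real.log (expLoss M nu)) ^ 2 ≤ B * B ^ 2 := by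
            gcongr
            exact h1.trans hnu
        _ = B ^ 3 := by ring
    · rw [Nat.cast_zero, mul_zero]
      positivity
  · rintro t mu j ⟨h1, h2⟩ hj hj1
    refine ⟨(expLoss_add_single_le_self hm M hM mu j hj1).trans h1, fun hpos => ?_⟩
    set r := finCorr M mu j with hr
    set a := 1 / 2 * (Real.log (1 + r) - Real.log (1 - r)) with ha
    have hr2 : 0 < 1 - r ^ 2 := sub_pos.2 ((sq_lt_one_iff_abs_lt_one r).2 hj1)
    have hdec : Real.log (expLoss M (mu + Pi.single j a))
        ≤ 1 / 2 * Real.log (1 - r ^ 2) + Real.log (expLoss M mu) := by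
      have h3 := Real.log_le_log (expLoss_pos hm M _)
        (expLoss_add_single_le hm M hM mu j hr.symm hj1)
      rw [Real.log_mul (Real.sqrt_pos.2 hr2).ne' (expLoss_pos hm M mu).ne',
        Real.log_sqrt hr2.le] at h3
      linarith
    have hlog : Real.log (1 - r ^ 2) ≤ 0 := Real.log_nonpos hr2.le (by nlinarith [sq_nonneg r])
    obtain ⟨S, hS, hdist, hSR, hRt⟩ := h2 (by linarith)
    have hra : |r| * |a| ≤ -Real.log (1 - |r| ^ 2) := by
      have h3 : 0 ≤ r * a := mul_artanh_nonneg hj1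
      have h4 : r * a ≤ -Real.log (1 - r ^ 2) := mul_artanh_le hj1
      rwa [← abs_mul, abs_of_nonneg h3, sq_abs]
    clear_value r a
    have hedge := (log_expLoss_sub_le hm M mu nu |r| hj).trans
      (mul_le_mul_of_nonneg_left hdist (abs_nonneg r))
    have hdec' : Real.log (expLoss M (mu + Pi.single j a)) - Real.log (expLoss M nu)
        ≤ Real.log (expLoss M mu) - Real.log (expLoss M nu) + 1 / 2 * Real.log (1 - |r| ^ 2) := by
      rw [sq_abs]
      linarith
    generalize Real.log (expLoss M mu) - Real.log (expLoss M nu) = R at hSR hRt hedge hdec'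
    generalize Real.log (expLoss M (mu + Pi.single j a)) - Real.log (expLoss M nu) = R' at *
    obtain ⟨h3, h4⟩ := rate_step hB hS (abs_nonneg r) hj1 (abs_nonneg a) (Nat.cast_nonneg t)
      hedge hdec' hra hSR hRt hpos
    refine ⟨S + |a|, by positivity, ?_, h3, by push_cast; exact h4⟩
    calc l1norm (nu - (mu + Pi.single j a)) = l1norm ((nu - mu) + Pi.single j (-a)) := by
          rw [Pi.single_neg]; congr 1; abel
      _ ≤ l1norm (nu - mu) + l1norm (Pi.single j (-a)) := l1norm_add_le _ _
      _ ≤ S + |a| := by rw [l1norm_single, abs_neg]; gcongr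

/-- Powers of `m ^ m` are absorbed by the constant, since `51 ≤ 100 log 2`. -/
theorem pow_le_two_rpow {m : ℕ} (hm : 0 < m) {k : ℕ} (hk : k ≤ 51) :
    (m : ℝ) ^ (k * m) ≤ (2 : ℝ) ^ ((100 : ℝ) * (m * Real.log m)) := by
  have hm1 : (1 : ℝ) ≤ m := by exact_mod_cast hm
  have hlog : 0 ≤ Real.log m := Real.log_nonneg hm1
  have hk' : (k : ℝ) ≤ 51 := by exact_mod_cast hk
  have h1 : (m : ℝ) ^ (k * m) = Real.exp (k * (m * Real.log m)) := by
    rw [← Real.exp_log (show (0 : ℝ) < (m : ℝ) ^ (k * m) by positivity), Real.log_pow]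
    push_cast
    ring_nf
  rw [h1, Real.rpow_def_of_pos (by norm_num), ← mul_assoc (Real.log 2)]
  gcongr
  linarith [Real.log_two_gt_d9]

theorem IsAdaBoostRun.extLoss_le {m N : ℕ} (hm : 0 < m) {M : Matrix (Fin m) (Fin N) ℝ}
    (hM : ∀ i j, M i j = -1 ∨ M i j = 0 ∨ M i j = 1) {lam : ℕ → Fin N → EReal}
    (hrun : IsAdaBoostRun M lam) {ε : ℝ} (hε : 0 < ε) (hε1 : ε < 1) {t : ℕ}
    (ht : (m : ℝ) ^ (51 * m) * Real.log (1 / ε) ^ 6 * (ε ^ 5)⁻¹ ≤ t) :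
    extLoss M (lam t) ≤ ENNReal.ofReal (optLoss M + ε) := by
  have hlog : 0 < Real.log (1 / ε) := Real.log_pos (by rw [lt_div_iff₀ hε]; linarith)
  have ht0 : (0 : ℝ) < t := lt_of_lt_of_le (by positivity) ht
  have hopt0 := optLoss_nonneg hm M
  rcases le_or_gt 1 (optLoss M) with hopt | hopt
  · refine (hrun.extLoss_le_one hm hM t).trans ?_
    rw [← ENNReal.ofReal_one]
    exact ENNReal.ofReal_le_ofReal (by linarith)
  rcases le_or_gt √(1 - (1 / (m : ℝ)) ^ 2) ε with hs | hs
  · exact (hrun.extLoss_le_sqrt hm hM hopt (by exact_mod_cast ht0)).trans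
      (ENNReal.ofReal_le_ofReal (by linarith))
  have hm2 : 2 ≤ m := by
    by_contra! h
    obtain rfl : m = 1 := by omega
    norm_num at hs
    linarith
  have hmr : (2 : ℝ) ≤ m := by exact_mod_cast hm2
  -- now `ε` is bounded away from `1`, and `log (2 / ε)` is comparable with `log (1 / ε)`
  have hlow : 1 ≤ 2 * (m : ℝ) ^ 2 * Real.log (1 / ε) := by
    have h1 : Real.log ε ≤ -(1 / (m : ℝ)) ^ 2 / 2 := by
      have hpos : 0 < 1 - (1 / (m : ℝ)) ^ 2 := Real.sqrt_pos.1 (hε.trans hs)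
      have h2 := Real.log_le_log hε hs.le
      rw [Real.log_sqrt hpos.le] at h2
      linarith [Real.log_le_sub_one_of_pos hpos]
    rw [one_div, Real.log_inv]
    calc (1 : ℝ) = 2 * (m : ℝ) ^ 2 * -(-(1 / (m : ℝ)) ^ 2 / 2) := by field_simp
      _ ≤ _ := by gcongr
  have hcomp : Real.log (1 / (ε / 2)) ≤ (m : ℝ) ^ 4 * Real.log (1 / ε) := by
    have h1 : Real.log (1 / (ε / 2)) = Real.log 2 + Real.log (1 / ε) := by
      rw [← Real.log_mul (by norm_num) (by positivity)]
      congr 1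
      field_simp
    have h2 : Real.log 2 ≤ 1 := by linarith [Real.log_two_lt_d9]
    have h3 : 2 * (m : ℝ) ^ 2 + 1 ≤ (m : ℝ) ^ 4 := by
      have : (4 : ℝ) ≤ (m : ℝ) ^ 2 := by nlinarith
      nlinarith
    nlinarith
  obtain ⟨nu, hnu, hnuL⟩ := exists_small_near_opt hm M hM (half_pos hε) (by linarith)
  set B := (m : ℝ) ^ (6 * m) * ((m : ℝ) ^ 4 * Real.log (1 / ε)) with hBdef
  have hB : 0 < B := by positivity
  have hBt : 64 * B ^ 6 ≤ ε ^ 5 * t := by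
    have h1 : 64 * B ^ 6 ≤ (m : ℝ) ^ (51 * m) * Real.log (1 / ε) ^ 6 := by
      calc 64 * B ^ 6 = 2 ^ 6 * ((m : ℝ) ^ (36 * m + 24) * Real.log (1 / ε) ^ 6) := by
            rw [hBdef]; ring
        _ ≤ (m : ℝ) ^ 6 * ((m : ℝ) ^ (36 * m + 24) * Real.log (1 / ε) ^ 6) := by gcongr
        _ = (m : ℝ) ^ (36 * m + 30) * Real.log (1 / ε) ^ 6 := by ring
        _ ≤ (m : ℝ) ^ (51 * m) * Real.log (1 / ε) ^ 6 := by
            gcongr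
            · linarith
            · omega
    rw [← div_eq_mul_inv, div_le_iff₀ (by positivity)] at ht
    linarith
  rcases hrun.rate hm hM nu hB (hnu.trans (mul_le_mul_of_nonneg_left hcomp (by positivity))) t
    with h | ⟨mu, hmu, hmu1, hR⟩
  · rw [h]; exact zero_le
  rw [hmu, extLoss_coe hm]
  refine ENNReal.ofReal_le_ofReal ?_
  set R := Real.log (expLoss M mu) - Real.log (expLoss M nu) with hRdef
  have hRε : R ≤ ε / 2 := by
    by_contra! h
    have h1 := hR (by linarith)
    have h2 : (ε / 2) ^ 5 * t < R ^ 5 * t := by gcongr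
    have h3 : (ε / 2) ^ 5 * t = ε ^ 5 * t / 32 := by ring
    linarith
  have hmupos := expLoss_pos hm M mu
  have hnupos := expLoss_pos hm M nu
  have hnumu : expLoss M nu = expLoss M mu * Real.exp (-R) := by
    rw [← Real.exp_log hnupos]
    conv_rhs => rw [← Real.exp_log hmupos, ← Real.exp_add]
    rw [hRdef]
    congr 1
    ring
  have hexp : 1 - ε / 2 ≤ Real.exp (-R) := by linarith [Real.add_one_le_exp (-R)]
  have : expLoss M mu * (1 - ε / 2) ≤ expLoss M nu := by
    rw [hnumu]; gcongr
  nlinarith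

end Boost

end

theorem mainTheorem9 :
    ∃ c : ℝ, 0 < c ∧
      ∀ (m N : ℕ) (_hm : 0 < m) (M : Matrix (Fin m) (Fin N) ℝ)
        (_hM : ∀ i j, M i j = -1 ∨ M i j = 0 ∨ M i j = 1) (ε : ℝ) (_hε : 0 < ε),
        (∃ lam : Fin N → ℝ,
          Boost.l1norm lam ≤
            (2 : ℝ) ^ (c * (m * Real.log m)) * max 0 (Real.log (1 / ε)) ∧
          Boost.expLoss M lam ≤ Boost.optLoss M + ε) ∧
        (∀ lam : ℕ → Fin N → EReal, Boost.IsAdaBoostRun M lam →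
          ∀ t : ℕ,
            (2 : ℝ) ^ (c * (m * Real.log m)) * max 0 (Real.log (1 / ε)) ^ 6 * (ε ^ 5)⁻¹ ≤ t →
            Boost.extLoss M (lam t) ≤ ENNReal.ofReal (Boost.optLoss M + ε)) := by
  refine ⟨100, by norm_num, fun m N hm M hM ε hε => ?_⟩
  have hopt0 := Boost.optLoss_nonneg hm M
  rcases lt_or_ge ε 1 with hε1 | hε1
  · have hlog : 0 ≤ Real.log (1 / ε) := Real.log_nonneg (by rw [le_div_iff₀ hε]; linarith)
    rw [max_eq_right hlog]
    refine ⟨?_, fun lam hrun t ht => ?_⟩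
    · obtain ⟨lam, h1, h2⟩ := Boost.exists_small_near_opt hm M hM hε hε1
      refine ⟨lam, h1.trans ?_, h2⟩
      exact mul_le_mul_of_nonneg_right (Boost.pow_le_two_rpow hm (by norm_num)) hlog
    · refine hrun.extLoss_le hm hM hε hε1 (le_trans ?_ ht)
      gcongr
      exact Boost.pow_le_two_rpow hm le_rfl
  -- for `ε ≥ 1` the combination `0` and every later one will do, as their loss is at most `1`
  · refine ⟨⟨0, ?_, ?_⟩, fun lam hrun t _ => ?_⟩
    · have : Boost.l1norm (0 : Fin N → ℝ) = 0 := by simp [Boost.l1norm]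
      rw [this]
      positivity
    · rw [Boost.expLoss_zero hm]
      linarith
    · refine (hrun.extLoss_le_one hm hM t).trans ?_
      rw [← ENNReal.ofReal_one]
      exact ENNReal.ofReal_le_ofReal (by linarith)
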